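/- All cardinal functions are taken to be infinite: for a topological space $Y$, the $\pi$-weight $\pi w(Y)$ is the least cardinality of a $\pi$-base of $Y$ (a family of non-empty open sets such that every non-empty open set contains a member of it), plus $\omega$; the cellularity $c(Y)$ is the supremum of the cardinalities of families of pairwise disjoint non-empty open subsets of $Y$, plus $\omega$. A space $Y$ is selectively highly divergent (SHD) if for every sequence $(U_n)_{n\in\omega}$ of non-empty open subsets of $Y$ there are points $x_n\in U_n$ such that $(x_n)$ has no convergent subsequence. A space is zero-dimensional if its clopen sets form a base, extremally disconnected if closures of open sets are open, and semiregular if its regular open sets form a base. For a Hausdorff space $X$ let $R(X)$ be the Boolean algebra of regular closed subsets of $X$, with order $\subseteq$ and meet $A\wedge B=\mathrm{cl}\,\mathrm{int}(A\cap B)$; let $\theta X$ be the set of ultrafilters of $R(X)$ with the topology generated by the sets $\lambda(A)=\{\mathscr U\in\theta X: A\in\mathscr U\}$, $A\in R(X)$; let $EX=\{\mathscr U\in\theta X:\bigcap\mathscr U\neq\emptyset\}$ be the Iliadis absolute, as a subspace of $\theta X$, and let $k_X:EX\to X$ be the map determined by $k_X(\mathscr U)\in\bigcap\mathscr U$. Theorem.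 Let $X$ be a Hausdorff space without isolated points. (I) There is an extremally disconnected zero-dimensional Hausdorff space $sX$ without isolated points, which is SHD, such that $|sX|=|X|$, $\pi w(sX)=\pi w(X)$ and $c(sX)=c(X)$. (II) There is a dense subspace $S$ of $EX$ that has exactly one point in each fiber of $k_X$, that is extremally disconnected, zero-dimensional, Hausdorff, without isolated points and SHD, and that satisfies $|S|=|X|$, $c(S)=c(X)$ and $\pi w(S)\le\pi w(X)$; if $X$ is semiregular, then also $\pi w(S)=\pi w(X)$, so that $S$ can serve as $sX$ in (I). -/

import Mathlib

open Set Filter Topology Cardinal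

universe u

namespace Absolute

/-- Selectively highly divergent spaces. -/
def IsSHD (X : Type u) [TopologicalSpace X] : Prop :=
  ∀ U : ℕ → Set X, (∀ n, IsOpen (U n) ∧ (U n).Nonempty) →
    ∃ x : ℕ → X, (∀ n, x n ∈ U n) ∧
      ∀ φ : ℕ → ℕ, StrictMono φ → ∀ a : X, ¬ Tendsto (x ∘ φ) atTop (𝓝 a)

/-- Zero-dimensional: the clopen sets form a base. -/
def IsZeroDimensional (X : Type u) [TopologicalSpace X] : Prop :=
  TopologicalSpace.IsTopologicalBasis {s : Set X | IsClopen s}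

/-- Semiregular: the regular open sets form a base. -/
def IsSemiregular (X : Type u) [TopologicalSpace X] : Prop :=
  TopologicalSpace.IsTopologicalBasis {s : Set X | interior (closure s) = s}

/-- A `π`-base: a family of non-empty open sets such that every non-empty open set
contains a member of the family. -/
def IsPiBase {X : Type u} [TopologicalSpace X] (B : Set (Set X)) : Prop :=
  (∀ V ∈ B, IsOpen V ∧ V.Nonempty) ∧
    ∀ U : Set X, IsOpen U → U.Nonempty → ∃ V ∈ B, V ⊆ U

/-- A cellular family: pairwise disjoint non-empty open sets. -/
def IsCellular {X : Type u} [TopologicalSpace X] (C : Set (Set X)) : Prop :=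
  (∀ V ∈ C, IsOpen V ∧ V.Nonempty) ∧ C.PairwiseDisjoint id

/-- The `π`-weight, with the usual convention that cardinal functions are infinite. -/
noncomputable def piWeight (X : Type u) [TopologicalSpace X] : Cardinal.{u} :=
  sInf {κ : Cardinal.{u} | ∃ B : Set (Set X), IsPiBase B ∧ #B = κ} + ℵ₀

/-- The cellularity, with the usual convention that cardinal functions are infinite. -/
noncomputable def cellularity (X : Type u) [TopologicalSpace X] : Cardinal.{u} :=
  sSup {κ : Cardinal.{u} | ∃ C : Set (Set X), IsCellular C ∧ #C = κ} + ℵ₀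

/-- `A` is regular closed. -/
def IsRegClosed {X : Type u} [TopologicalSpace X] (A : Set X) : Prop :=
  closure (interior A) = A

/-- Proper filters of the Boolean algebra of regular closed sets, in which the order is inclusion
and the meet of `A` and `B` is `closure (interior (A ∩ B))`. -/
structure IsRegFilter {X : Type u} [TopologicalSpace X] (F : Set (Set X)) : Prop where
  regClosed : ∀ A ∈ F, IsRegClosed A
  nonempty : F.Nonempty
  empty_notMem : ∅ ∉ F
  meet_mem : ∀ A ∈ F, ∀ B ∈ F, closure (interior (A ∩ B)) ∈ F
  mono : ∀ A ∈ F, ∀ B, IsRegClosed B → A ⊆ B → B ∈ F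

/-- Ultrafilters of regular closed sets: the maximal proper filters. -/
def IsRegUltrafilter {X : Type u} [TopologicalSpace X] (F : Set (Set X)) : Prop :=
  Maximal IsRegFilter F

/-- The space `θX` of ultrafilters of regular closed sets. -/
def Theta (X : Type u) [TopologicalSpace X] : Type u :=
  {F : Set (Set X) // IsRegUltrafilter F}

/-- The set `λ(A)` of the ultrafilters that contain `A`. -/
def lam {X : Type u} [TopologicalSpace X] (A : Set X) : Set (Theta X) :=
  {F | A ∈ F.1}

/-- The topology of `θX` generated by the sets `λ(A)`, `A` regular closed. -/
instance instTopologicalSpaceTheta (X : Type u) [TopologicalSpace X] :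
    TopologicalSpace (Theta X) :=
  TopologicalSpace.generateFrom {s | ∃ A : Set X, IsRegClosed A ∧ s = lam A}

/-- The Iliadis absolute `EX`: the subspace of fixed ultrafilters. -/
abbrev IliadisAbsolute (X : Type u) [TopologicalSpace X] : Type u :=
  {F : Theta X // (⋂₀ F.1).Nonempty}

/-- The map `k_X : EX → X` with `k_X(F) ∈ ⋂ F`. -/
noncomputable def kMap (X : Type u) [TopologicalSpace X] (F : IliadisAbsolute X) : X :=
  F.2.some

theorem isRegClosed_closure {X : Type u} [TopologicalSpace X] {V : Set X} (hV : IsOpen V) :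
    IsRegClosed (closure V) := by
  refine subset_antisymm ?_ (closure_mono hV.subset_interior_closure)
  exact closure_minimal interior_subset isClosed_closure

theorem IsRegUltrafilter.mem_or {X : Type u} [TopologicalSpace X] {F : Set (Set X)}
    (hF : IsRegUltrafilter F) {V : Set X} (hV : IsOpen V) :
    closure V ∈ F ∨ closure (closure V)ᶜ ∈ F := by
  have hf : IsRegFilter F := hF.1
  have hcl : ∀ A ∈ F, IsClosed A := fun A hA => by
    rw [← hf.regClosed A hA]; exact isClosed_closure
  let G : Set (Set X) :=
    {B | IsRegClosed B ∧ ∃ A ∈ F, interior (A ∩ closure V) ⊆ B}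
  by_cases hG : ∅ ∈ G
  · right
    obtain ⟨-, A, hA, hAV⟩ := hG
    refine hf.mono A hA _ (isRegClosed_closure isClosed_closure.isOpen_compl) ?_
    rw [← hf.regClosed A hA]
    refine closure_mono fun x hx hxV => ?_
    obtain ⟨y, hyA, hyV⟩ := mem_closure_iff.1 hxV _ isOpen_interior hx
    refine hAV (?_ : y ∈ interior (A ∩ closure V))
    rw [interior_inter]
    exact ⟨hyA, hV.subset_interior_closure hyV⟩
  · left
    have hGf : IsRegFilter G := by
      refine ⟨fun B hB => hB.1, ?_, hG, ?_, ?_⟩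
      · obtain ⟨A, hA⟩ := hf.nonempty
        exact ⟨A, hf.regClosed A hA, A, hA, interior_subset.trans inter_subset_left⟩
      · rintro B₁ ⟨-, A₁, hA₁, h₁⟩ B₂ ⟨-, A₂, hA₂, h₂⟩
        refine ⟨isRegClosed_closure isOpen_interior, _, hf.meet_mem A₁ hA₁ A₂ hA₂, ?_⟩
        have hsub : closure (interior (A₁ ∩ A₂)) ⊆ A₁ ∩ A₂ :=
          closure_minimal interior_subset ((hcl A₁ hA₁).inter (hcl A₂ hA₂))
        refine subset_trans (interior_maximal ?_ isOpen_interior) subset_closure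
        exact subset_inter
          ((interior_mono (inter_subset_inter_left _ (hsub.trans inter_subset_left))).trans h₁)
          ((interior_mono (inter_subset_inter_left _ (hsub.trans inter_subset_right))).trans h₂)
      · rintro B ⟨-, A, hA, h⟩ C hC hBC
        exact ⟨hC, A, hA, h.trans hBC⟩
    have hle : F ≤ G := fun A hA =>
      ⟨hf.regClosed A hA, A, hA, interior_subset.trans inter_subset_left⟩
    refine hF.2 hGf hle ⟨isRegClosed_closure hV, ?_⟩
    obtain ⟨A, hA⟩ := hf.nonempty
    exact ⟨A, hA, interior_subset.trans inter_subset_right⟩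

/-- For Hausdorff `X`, the condition `k_X(F) ∈ ⋂ F` determines `k_X(F)`. -/
theorem kMap_eq_iff {X : Type u} [TopologicalSpace X] [T2Space X] (F : IliadisAbsolute X) (x : X) :
    kMap X F = x ↔ x ∈ ⋂₀ F.1.1 := by
  have hk : kMap X F ∈ ⋂₀ F.1.1 := F.2.some_mem
  refine ⟨fun h => h ▸ hk, fun hx => ?_⟩
  by_contra hne
  obtain ⟨U, V, hU, hV, hkU, hxV, hUV⟩ := t2_separation hne
  rcases F.1.2.mem_or hU with h | h
  · obtain ⟨y, hyV, hyU⟩ := mem_closure_iff.1 (hx _ h) V hV hxV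
    exact hUV.le_bot ⟨hyU, hyV⟩
  · obtain ⟨y, hyU, hy⟩ := mem_closure_iff.1 (hk _ h) U hU hkU
    exact hy (subset_closure hyU)

end Absolute

/-! Choose for each `x` an ultrafilter of regular closed sets fixed at `x`; the range `S` of any
such section works in (II). If `x ∈ U` is open, an ultrafilter fixed at `x` must contain `closure
U`, since the complementary regular closed set misses `x` (`sectionPoint_mem_trace`). Hence the
clopen base of traces of `λ(cl U)` on `S` mirrors the open sets of `X` up to closure: non-emptiness
and disjointness agree, and inclusion of traces means `U ⊆ closure V`. Density, absence of isolated
points, extremal disconnectedness and the cardinal functions follow from this dictionary.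

SHD comes from two general facts: non-empty open sets of a crowded Hausdorff space are infinite, so
a sequence of them has an injective choice of points; and an extremally disconnected Hausdorff space
has no injective convergent sequence (`not_tendsto_of_injective`).

Traces see `U` only up to `interior (closure U)`, so the `π`-weight may drop unless `X` is
semiregular. For (I), a non-empty `X` is first replaced by `Y = S ⊕ Z`, with `Z` dense in a Cantor
cube of weight `πw(X)` and `|Z| ≤ |X|`. The summand `Z` restores the `π`-weight and, being ccc,
leaves the cellularity unchanged. `Y` is zero-dimensional, hence semiregular, and (II) applied to
`Y` gives (I). -/

namespace Absolute

/-! ### Crowded spaces and injective sequences -/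

section General

variable {X : Type u} [TopologicalSpace X]

theorem perfectSpace_of_forall_exists_ne
    (h : ∀ (x : X) (U : Set X), IsOpen U → x ∈ U → ∃ y ∈ U, y ≠ x) : PerfectSpace X := by
  refine perfectSpace_iff_forall_not_isolated.2 fun x => ?_
  rw [← mem_closure_iff_nhdsWithin_neBot, mem_closure_iff]
  intro U hU hx
  obtain ⟨y, hy, hne⟩ := h x U hU hx
  exact ⟨y, hy, hne⟩

theorem exists_mem_ne_of_isOpen [PerfectSpace X] {x : X} {U : Set X} (hU : IsOpen U) (hx : x ∈ U) :
    ∃ y ∈ U, y ≠ x := by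
  have h := perfectSpace_iff_forall_not_isolated.1 ‹_› x
  rw [← mem_closure_iff_nhdsWithin_neBot, mem_closure_iff] at h
  obtain ⟨y, hy, hne⟩ := h U hU hx
  exact ⟨y, hy, hne⟩

theorem infinite_of_isOpen [T2Space X] [PerfectSpace X] {U : Set X} (hU : IsOpen U)
    (hne : U.Nonempty) : U.Infinite := by
  obtain ⟨x, hx⟩ := hne
  have := perfectSpace_iff_forall_not_isolated.1 ‹_› x
  exact infinite_of_mem_nhds x (hU.mem_nhds hx)

/-- A family of infinite sets indexed by `ℕ` has an injective choice function. -/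
theorem exists_injective_choice {α : Type*} {U : ℕ → Set α} (hU : ∀ n, (U n).Infinite) :
    ∃ x : ℕ → α, Function.Injective x ∧ ∀ n, x n ∈ U n := by
  classical
  -- Hall's condition holds for finite `T n ⊆ U n` with `n + 1` elements: for an index set `s` with
  -- maximum `m`, already `T m` has `m + 1 ≥ |s|` elements.
  choose T hTU hT using fun n => (hU n).exists_subset_card_eq (n + 1)
  obtain ⟨x, hx, hxT⟩ := (Finset.all_card_le_biUnion_card_iff_exists_injective T).1 (by
    intro s
    rcases s.eq_empty_or_nonempty with rfl | hs
    · simp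
    · calc s.card ≤ (Finset.range (s.max' hs + 1)).card :=
            Finset.card_le_card fun i hi => by
              simpa [Nat.lt_succ_iff] using s.le_max' i hi
        _ = (T (s.max' hs)).card := by simp [hT]
        _ ≤ _ := Finset.card_le_card (Finset.subset_biUnion_of_mem T (s.max'_mem hs)))
  exact ⟨x, hx, fun n => hTU n (hxT n)⟩

/-- An extremally disconnected Hausdorff space has no injective convergent sequences. -/
theorem not_tendsto_of_injective [T2Space X] [ExtremallyDisconnected X] {x : ℕ → X}
    (hx : Function.Injective x) (a : X) : ¬ Tendsto x atTop (𝓝 a) := by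
  intro hlim
  have hsep : ∀ n, ∃ P Q : Set X, x n ≠ a → IsOpen P ∧ IsOpen Q ∧ x n ∈ P ∧ a ∈ Q ∧ Disjoint P Q := by
    intro n
    by_cases h : x n = a
    · exact ⟨∅, ∅, fun h' => (h' h).elim⟩
    · obtain ⟨P, Q, h⟩ := t2_separation h
      exact ⟨P, Q, fun _ => h⟩
  choose P Q hPQ using hsep
  have hne : ∀ᶠ n in atTop, x n ≠ a := by
    have : Tendsto x cofinite cofinite := hx.tendsto_cofinite
    rw [Nat.cofinite_eq_atTop] at this
    exact this.eventually (eventually_cofinite_ne a)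
  -- Recursive thinning: each new term lies in the neighbourhoods `Q` of the limit attached to all
  -- earlier terms. Cutting `P (f n)` down by these `Q` gives pairwise disjoint neighbourhoods `W n`
  -- of the terms.
  obtain ⟨f, hf, hfr⟩ := exists_seq_of_forall_finset_exists (fun n => x n ≠ a)
    (fun m n => m < n ∧ x n ∈ Q m) (by
      intro s hs
      have h1 : ∀ᶠ n in atTop, ∀ m ∈ s, m < n ∧ x n ∈ Q m :=
        (eventually_all_finset s).2 fun m hm => (eventually_gt_atTop m).and
          (hlim.eventually ((hPQ m (hs m hm)).2.1.mem_nhds (hPQ m (hs m hm)).2.2.2.1))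
      exact (hne.and h1).exists)
  have hmono : StrictMono f := fun m n h => (hfr m n h).1
  let W : ℕ → Set X := fun n => P (f n) ∩ ⋂ m ∈ Finset.range n, Q (f m)
  have hWo : ∀ n, IsOpen (W n) := fun n => (hPQ _ (hf n)).1.inter
    (isOpen_biInter_finset fun m _ => (hPQ _ (hf m)).2.1)
  have hWx : ∀ n, x (f n) ∈ W n := fun n => ⟨(hPQ _ (hf n)).2.2.1, by
    simp only [Finset.mem_range, mem_iInter]
    exact fun m hm => (hfr m n hm).2⟩
  have hWlt : ∀ m n, m < n → Disjoint (W m) (W n) := fun m n h =>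
    ((hPQ _ (hf m)).2.2.2.2).mono inter_subset_left
      (inter_subset_right.trans (biInter_subset_of_mem (by simpa using h)))
  have hWd : ∀ m n, m ≠ n → Disjoint (W m) (W n) := fun m n h =>
    h.lt_or_gt.elim (hWlt m n) fun h => (hWlt n m h).symm
  -- The limit is in the closure of both the even and the odd union, but disjoint open sets have
  -- disjoint closures here.
  have hdisj : Disjoint (⋃ k, W (2 * k)) (⋃ k, W (2 * k + 1)) := by
    simp only [disjoint_iUnion_left, disjoint_iUnion_right]
    exact fun i j => hWd _ _ (by omega)
  have hcl := ExtremallyDisconnected.disjoint_closure_of_disjoint_isOpen hdisj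
    (isOpen_iUnion fun k => hWo _) (isOpen_iUnion fun k => hWo _)
  have hlim' : Tendsto (x ∘ f) atTop (𝓝 a) := hlim.comp hmono.tendsto_atTop
  have h2 : Tendsto (fun k : ℕ => 2 * k) atTop atTop :=
    StrictMono.tendsto_atTop fun i j h => by omega
  have h3 : Tendsto (fun k : ℕ => 2 * k + 1) atTop atTop :=
    StrictMono.tendsto_atTop fun i j h => by omega
  exact hcl.le_bot
    ⟨mem_closure_of_tendsto (hlim'.comp h2) (Eventually.of_forall fun k => mem_iUnion.2 ⟨k, hWx _⟩),
      mem_closure_of_tendsto (hlim'.comp h3) (Eventually.of_forall fun k => mem_iUnion.2 ⟨k, hWx _⟩)⟩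

theorem isSHD_of_extremallyDisconnected [T2Space X] [ExtremallyDisconnected X] [PerfectSpace X] :
    IsSHD X := by
  intro U hU
  obtain ⟨x, hx, hxU⟩ := exists_injective_choice fun n => infinite_of_isOpen (hU n).1 (hU n).2
  exact ⟨x, hxU, fun φ hφ a => not_tendsto_of_injective (hx.comp hφ.injective) a⟩

theorem IsZeroDimensional.isSemiregular (h : IsZeroDimensional X) : IsSemiregular X := by
  refine TopologicalSpace.isTopologicalBasis_of_isOpen_of_nhds
    (fun U hU => by rw [← (hU : interior (closure U) = U)]; exact isOpen_interior) fun a U ha hU => ?_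
  obtain ⟨V, hV, haV, hVU⟩ := h.exists_subset_of_mem_open ha hU
  exact ⟨V, by rw [mem_ofPred_eq, hV.1.closure_eq, hV.2.interior_eq], haV, hVU⟩

end General

/-! ### Cardinal functions and their behaviour on sums -/

section CardinalFunctions

variable {X : Type u} [TopologicalSpace X]

theorem aleph0_le_piWeight : ℵ₀ ≤ piWeight X := self_le_add_left _ _

theorem aleph0_le_cellularity : ℵ₀ ≤ cellularity X := self_le_add_left _ _

theorem exists_isPiBase_mk_le : ∃ B : Set (Set X), IsPiBase B ∧ #B ≤ piWeight X := by
  have hne : {κ : Cardinal.{u} | ∃ B : Set (Set X), IsPiBase B ∧ #B = κ}.Nonempty :=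
    ⟨_, {V | IsOpen V ∧ V.Nonempty}, ⟨fun _ h => h, fun U hU h => ⟨U, ⟨hU, h⟩, subset_rfl⟩⟩, rfl⟩
  obtain ⟨B, hB, h⟩ := csInf_mem hne
  exact ⟨B, hB, h.trans_le (self_le_add_right _ _)⟩

theorem piWeight_le_of_family {ι : Type u} {κ : Cardinal.{u}} (hκ : ℵ₀ ≤ κ) (hι : #ι ≤ κ)
    (f : ι → Set X) (ho : ∀ i, IsOpen (f i)) (hne : ∀ i, (f i).Nonempty)
    (hf : ∀ U : Set X, IsOpen U → U.Nonempty → ∃ i, f i ⊆ U) : piWeight X ≤ κ := by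
  have hB : IsPiBase (range f) := by
    refine ⟨?_, fun U hU h => ?_⟩
    · rintro _ ⟨i, rfl⟩
      exact ⟨ho i, hne i⟩
    · obtain ⟨i, hi⟩ := hf U hU h
      exact ⟨_, ⟨i, rfl⟩, hi⟩
  have hmem : #(range f) ∈ {κ : Cardinal.{u} | ∃ B : Set (Set X), IsPiBase B ∧ #B = κ} :=
    ⟨_, hB, rfl⟩
  exact Cardinal.add_le_of_le hκ ((csInf_le' hmem).trans (mk_range_le.trans hι)) hκ

theorem mk_le_cellularity {ι : Type u} (f : ι → Set X) (ho : ∀ i, IsOpen (f i))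
    (hne : ∀ i, (f i).Nonempty) (hf : Pairwise (Function.onFun Disjoint f)) :
    #ι ≤ cellularity X := by
  have hinj : Function.Injective f := fun i j h => by
    by_contra hij
    have := hf hij
    rw [Function.onFun, h, disjoint_self] at this
    exact (hne j).ne_empty this
  have hC : IsCellular (range f) := by
    refine ⟨?_, ?_⟩
    · rintro _ ⟨i, rfl⟩
      exact ⟨ho i, hne i⟩
    · rintro _ ⟨i, rfl⟩ _ ⟨j, rfl⟩ h
      exact hf fun hij => h (hij ▸ rfl)
  rw [← mk_range_eq f hinj]
  have hmem : #(range f) ∈ {κ : Cardinal.{u} | ∃ C : Set (Set X), IsCellular C ∧ #C = κ} :=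
    ⟨_, hC, rfl⟩
  -- The supremum of cardinals is only meaningful for a bounded set; `#(Set X)` is a bound.
  refine (le_csSup ⟨#(Set X), ?_⟩ hmem).trans (self_le_add_right _ _)
  rintro _ ⟨C, -, rfl⟩
  exact mk_set_le C

theorem cellularity_le {κ : Cardinal.{u}} (hκ : ℵ₀ ≤ κ)
    (h : ∀ C : Set (Set X), IsCellular C → #C ≤ κ) : cellularity X ≤ κ := by
  refine Cardinal.add_le_of_le hκ (csSup_le' ?_) hκ
  rintro _ ⟨C, hC, rfl⟩
  exact h C hC

theorem piWeight_sum_le {Y : Type u} [TopologicalSpace Y] {κ : Cardinal.{u}}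
    (hX : piWeight X ≤ κ) (hY : piWeight Y ≤ κ) : piWeight (X ⊕ Y) ≤ κ := by
  have hκ : ℵ₀ ≤ κ := aleph0_le_piWeight.trans hX
  obtain ⟨B, hB, hBκ⟩ := exists_isPiBase_mk_le (X := X)
  obtain ⟨D, hD, hDκ⟩ := exists_isPiBase_mk_le (X := Y)
  refine piWeight_le_of_family (ι := B ⊕ D) hκ ?_
    (Sum.elim (fun V => Sum.inl '' V.1) fun V => Sum.inr '' V.1) ?_ ?_ ?_
  · rw [← Cardinal.add_def]
    exact Cardinal.add_le_of_le hκ (hBκ.trans hX) (hDκ.trans hY)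
  · rintro (V | V)
    · exact isOpenMap_inl _ (hB.1 _ V.2).1
    · exact isOpenMap_inr _ (hD.1 _ V.2).1
  · rintro (V | V)
    · exact (hB.1 _ V.2).2.image _
    · exact (hD.1 _ V.2).2.image _
  · rintro U hU ⟨x | x, hx⟩
    · obtain ⟨V, hV, hVU⟩ := hB.2 _ (hU.preimage continuous_inl) ⟨x, hx⟩
      exact ⟨Sum.inl ⟨V, hV⟩, image_subset_iff.2 hVU⟩
    · obtain ⟨V, hV, hVU⟩ := hD.2 _ (hU.preimage continuous_inr) ⟨x, hx⟩
      exact ⟨Sum.inr ⟨V, hV⟩, image_subset_iff.2 hVU⟩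

theorem piWeight_le_sum_right {Y : Type u} [TopologicalSpace Y] :
    piWeight Y ≤ piWeight (X ⊕ Y) := by
  obtain ⟨B, hB, hBκ⟩ := exists_isPiBase_mk_le (X := X ⊕ Y)
  -- Members living in `X` have empty trace on `Y` and are discarded. A member contained in the
  -- image of an open subset of `Y` survives.
  refine piWeight_le_of_family (ι := {V : B // (Sum.inr ⁻¹' V.1 : Set Y).Nonempty})
    aleph0_le_piWeight ((mk_subtype_le _).trans hBκ) (fun V => Sum.inr ⁻¹' V.1.1)
    (fun V => (hB.1 _ V.1.2).1.preimage continuous_inr) (fun V => V.2) fun U hU hne => ?_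
  obtain ⟨V, hV, hVU⟩ := hB.2 _ (isOpenMap_inr (X := X) U hU) (hne.image _)
  obtain ⟨v, hv⟩ := (hB.1 V hV).2
  obtain ⟨y, hy, rfl⟩ := hVU hv
  refine ⟨⟨⟨V, hV⟩, y, hv⟩, fun z hz => ?_⟩
  obtain ⟨w, hw, hwz⟩ := hVU hz
  exact Sum.inr_injective hwz ▸ hw

theorem cellularity_le_sum_left {Y : Type u} [TopologicalSpace Y] :
    cellularity X ≤ cellularity (X ⊕ Y) := by
  refine cellularity_le aleph0_le_cellularity fun C hC => ?_
  refine mk_le_cellularity (fun V : C => (Sum.inl '' V.1 : Set (X ⊕ Y)))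
    (fun V => isOpenMap_inl _ (hC.1 _ V.2).1) (fun V => (hC.1 _ V.2).2.image _) fun V W h => ?_
  exact (disjoint_image_iff Sum.inl_injective).2 (hC.2 V.2 W.2 fun h' => h (Subtype.ext h'))

theorem cellularity_sum_le {Y : Type u} [TopologicalSpace Y] {κ : Cardinal.{u}}
    (hX : cellularity X ≤ κ) (hY : cellularity Y ≤ κ) : cellularity (X ⊕ Y) ≤ κ := by
  have hκ : ℵ₀ ≤ κ := aleph0_le_cellularity.trans hX
  refine cellularity_le hκ fun C hC => ?_
  have hdisj : ∀ V ∈ C, ∀ W ∈ C, V ≠ W → Disjoint V W := fun V hV W hW h => hC.2 hV hW h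
  -- Every member meets one of the summands, and those meeting a given summand have distinct
  -- disjoint traces there.
  have h1 : #{V : C // (Sum.inl ⁻¹' V.1 : Set X).Nonempty} ≤ κ :=
    (mk_le_cellularity (X := X) (fun V => Sum.inl ⁻¹' V.1.1)
      (fun V => (hC.1 _ V.1.2).1.preimage continuous_inl) (fun V => V.2) fun V W h =>
        (hdisj _ V.1.2 _ W.1.2 fun h' => h (Subtype.ext (Subtype.ext h'))).preimage _).trans hX
  have h2 : #{V : C // (Sum.inr ⁻¹' V.1 : Set Y).Nonempty} ≤ κ :=
    (mk_le_cellularity (X := Y) (fun V => Sum.inr ⁻¹' V.1.1)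
      (fun V => (hC.1 _ V.1.2).1.preimage continuous_inr) (fun V => V.2) fun V W h =>
        (hdisj _ V.1.2 _ W.1.2 fun h' => h (Subtype.ext (Subtype.ext h'))).preimage _).trans hY
  have hcover : ({V : C | (Sum.inl ⁻¹' V.1 : Set X).Nonempty} ∪
      {V : C | (Sum.inr ⁻¹' V.1 : Set Y).Nonempty}) = Set.univ := by
    refine eq_univ_of_forall fun V => ?_
    obtain ⟨x | x, hx⟩ := (hC.1 _ V.2).2
    · exact Or.inl ⟨x, hx⟩
    · exact Or.inr ⟨x, hx⟩
  rw [← mk_univ, ← hcover]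
  exact (mk_union_le _ _).trans (Cardinal.add_le_of_le hκ h1 h2)

end CardinalFunctions

end Absolute

/-! ### Ultrafilters of regular closed sets and subspaces of the absolute -/

namespace Absolute

variable {X : Type u} [TopologicalSpace X]

/-- The meet of `closure U` and `closure V` lies in `closure (U ∩ V)`. This allows indexing by open
sets, with meet replaced by intersection. -/
theorem IsRegFilter.closure_inter_mem {F : Set (Set X)} (hF : IsRegFilter F) {U V : Set X}
    (hU : IsOpen U) (hV : IsOpen V) (h₁ : closure U ∈ F) (h₂ : closure V ∈ F) :
    closure (U ∩ V) ∈ F := by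
  refine hF.mono _ (hF.meet_mem _ h₁ _ h₂) _ (isRegClosed_closure (hU.inter hV)) ?_
  refine closure_minimal (fun x hx => mem_closure_iff.2 fun O hO hxO => ?_) isClosed_closure
  obtain ⟨y, ⟨hyO, hy⟩, hyU⟩ := mem_closure_iff.1 (interior_subset hx).1 _
    (hO.inter isOpen_interior) ⟨hxO, hx⟩
  obtain ⟨z, ⟨hzO, hzU⟩, hzV⟩ := mem_closure_iff.1 (interior_subset hy).2 _
    (hO.inter hU) ⟨hyO, hyU⟩
  exact ⟨z, hzO, hzU, hzV⟩

theorem IsRegFilter.inter_nonempty {F : Set (Set X)} (hF : IsRegFilter F) {U V : Set X}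
    (hU : IsOpen U) (hV : IsOpen V) (h₁ : closure U ∈ F) (h₂ : closure V ∈ F) :
    (U ∩ V).Nonempty := by
  rw [nonempty_iff_ne_empty]
  intro h
  have := hF.closure_inter_mem hU hV h₁ h₂
  rw [h, closure_empty] at this
  exact hF.empty_notMem this

/-- Every point is in the intersection of some ultrafilter of regular closed sets. -/
theorem exists_isRegUltrafilter (x : X) : ∃ F : Set (Set X), IsRegUltrafilter F ∧ x ∈ ⋂₀ F := by
  -- The filter of regular closed neighbourhoods of `x`, to be extended by Zorn's lemma.
  let G : Set (Set X) := {A | IsRegClosed A ∧ x ∈ interior A}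
  have hG : IsRegFilter G := by
    refine ⟨fun A h => h.1, ⟨univ, by simp [G, IsRegClosed]⟩, fun h => by simpa using h.2, ?_, ?_⟩
    · rintro A ⟨-, hA⟩ B ⟨-, hB⟩
      refine ⟨isRegClosed_closure isOpen_interior, isOpen_interior.subset_interior_closure ?_⟩
      rw [interior_inter]
      exact ⟨hA, hB⟩
    · exact fun A hA B hB h => ⟨hB, interior_mono h hA.2⟩
  obtain ⟨F, hGF, hF⟩ := zorn_subset_nonempty {F : Set (Set X) | IsRegFilter F} (by
    intro c hc hchain hne
    refine ⟨⋃₀ c, ⟨?_, ?_, ?_, ?_, ?_⟩, fun s => subset_sUnion_of_mem⟩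
    · rintro A ⟨F, hF, hA⟩
      exact (hc hF).regClosed A hA
    · obtain ⟨F, hF⟩ := hne
      obtain ⟨A, hA⟩ := (hc hF).nonempty
      exact ⟨A, F, hF, hA⟩
    · rintro ⟨F, hF, h⟩
      exact (hc hF).empty_notMem h
    · rintro A ⟨F, hF, hA⟩ B ⟨F', hF', hB⟩
      rcases hchain.total hF hF' with h | h
      · exact ⟨F', hF', (hc hF').meet_mem A (h hA) B hB⟩
      · exact ⟨F, hF, (hc hF).meet_mem A hA B (h hB)⟩
    · rintro A ⟨F, hF, hA⟩ B hB h
      exact ⟨F, hF, (hc hF).mono A hA B hB h⟩) G hG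
  refine ⟨F, hF, fun A hA => ?_⟩
  by_contra hx
  have hAr := hF.1.regClosed A hA
  have hAc : IsClosed A := hAr ▸ isClosed_closure
  -- If `x ∉ A`, then `closure Aᶜ` is a regular closed neighbourhood of `x`, yet `Aᶜ` is disjoint
  -- from `interior A`.
  have hmem : closure Aᶜ ∈ F := hGF ⟨isRegClosed_closure hAc.isOpen_compl,
    hAc.isOpen_compl.subset_interior_closure hx⟩
  obtain ⟨y, hy, hy'⟩ := IsRegFilter.inter_nonempty hF.1 isOpen_interior hAc.isOpen_compl
    (hAr.symm ▸ hA) hmem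
  exact hy' (interior_subset hy)

theorem isTopologicalBasis_lam :
    TopologicalSpace.IsTopologicalBasis {s : Set (Theta X) | ∃ U, IsOpen U ∧ s = lam (closure U)} := by
  refine ⟨?_, ?_, ?_⟩
  · rintro _ ⟨U, hU, rfl⟩ _ ⟨V, hV, rfl⟩ F ⟨h₁, h₂⟩
    refine ⟨_, ⟨U ∩ V, hU.inter hV, rfl⟩, F.2.1.closure_inter_mem hU hV h₁ h₂, fun G hG => ?_⟩
    exact ⟨G.2.1.mono _ hG _ (isRegClosed_closure hU) (closure_mono inter_subset_left),
      G.2.1.mono _ hG _ (isRegClosed_closure hV) (closure_mono inter_subset_right)⟩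
  · refine eq_univ_of_forall fun F => ?_
    obtain ⟨A, hA⟩ := F.2.1.nonempty
    exact ⟨_, ⟨univ, isOpen_univ, rfl⟩,
      F.2.1.mono A hA _ (isRegClosed_closure isOpen_univ) (by simp)⟩
  · refine congrArg TopologicalSpace.generateFrom (Set.ext fun s => ⟨?_, ?_⟩)
    · rintro ⟨A, hA, rfl⟩
      exact ⟨interior A, isOpen_interior, by rw [(hA : closure (interior A) = A)]⟩
    · rintro ⟨U, hU, rfl⟩
      exact ⟨_, isRegClosed_closure hU, rfl⟩

/-- The trace on `S ⊆ EX` of the basic open set `λ(cl U)`. -/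
def trace (S : Set (IliadisAbsolute X)) (U : Set X) : Set S := {p | closure U ∈ p.1.1.1}

section Trace

variable (S : Set (IliadisAbsolute X)) {U V : Set X}

theorem isTopologicalBasis_trace :
    TopologicalSpace.IsTopologicalBasis {s : Set S | ∃ U, IsOpen U ∧ s = trace S U} := by
  have h := (isTopologicalBasis_lam (X := X)).isInducing
    (Topology.IsInducing.subtypeVal.comp (Topology.IsInducing.subtypeVal (t := S)))
  convert h using 1
  ext s
  constructor
  · rintro ⟨U, hU, rfl⟩
    exact ⟨_, ⟨U, hU, rfl⟩, rfl⟩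
  · rintro ⟨_, ⟨U, hU, rfl⟩, rfl⟩
    exact ⟨U, hU, rfl⟩

theorem isOpen_trace (hU : IsOpen U) : IsOpen (trace S U) :=
  (isTopologicalBasis_trace S).isOpen ⟨U, hU, rfl⟩

variable {S}

theorem inter_nonempty_of_mem_trace (hU : IsOpen U) (hV : IsOpen V) {p : S} (h₁ : p ∈ trace S U)
    (h₂ : p ∈ trace S V) : (U ∩ V).Nonempty :=
  p.1.1.2.1.inter_nonempty hU hV h₁ h₂

/-- An ultrafilter contains exactly one of the two complementary regular closed sets; hence traces
are clopen. -/
theorem trace_compl (hU : IsOpen U) : trace S (closure U)ᶜ = (trace S U)ᶜ := by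
  ext p
  refine ⟨fun h h' => ?_, fun h => (p.1.1.2.mem_or hU).resolve_left h⟩
  obtain ⟨x, hx, hx'⟩ := inter_nonempty_of_mem_trace isClosed_closure.isOpen_compl hU h h'
  exact hx (subset_closure hx')

variable (S) in
theorem isClopen_trace (hU : IsOpen U) : IsClopen (trace S U) := by
  refine ⟨⟨?_⟩, isOpen_trace S hU⟩
  rw [← trace_compl hU]
  exact isOpen_trace S isClosed_closure.isOpen_compl

theorem trace_mono (hV : IsOpen V) (h : U ⊆ V) : trace S U ⊆ trace S V := fun p hp =>
  p.1.1.2.1.mono _ hp _ (isRegClosed_closure hV) (closure_mono h)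

variable (S) in
theorem isZeroDimensional_of_subset : IsZeroDimensional S := by
  refine TopologicalSpace.isTopologicalBasis_of_isOpen_of_nhds (fun U hU => hU.2) fun a U ha hU => ?_
  obtain ⟨_, ⟨V, hV, rfl⟩, haV, hVU⟩ :=
    (isTopologicalBasis_trace S).exists_subset_of_mem_open ha hU
  exact ⟨_, isClopen_trace S hV, haV, hVU⟩

variable (S) in
theorem t2Space_of_subset : T2Space S := by
  refine ⟨fun p q hpq => ?_⟩
  -- By maximality, distinct ultrafilters are incomparable; a set in one but not the other gives a
  -- separating clopen trace.
  have hnot : ¬ p.1.1.1 ⊆ q.1.1.1 := fun h => hpq <| Subtype.ext <| Subtype.ext <| Subtype.ext <|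
    h.antisymm (p.1.1.2.2 q.1.1.2.1 h)
  obtain ⟨A, hAp, hAq⟩ := not_subset.1 hnot
  have hA : closure (interior A) = A := p.1.1.2.1.regClosed A hAp
  have ho := isClopen_trace S (isOpen_interior (s := A))
  refine ⟨_, _, ho.2, ho.compl.2, ?_, ?_, disjoint_compl_right⟩
  · change closure (interior A) ∈ p.1.1.1
    rwa [hA]
  · change ¬ closure (interior A) ∈ q.1.1.1
    rwa [hA]

theorem exists_trace_subset {W : Set S} (hW : IsOpen W) (hne : W.Nonempty) :
    ∃ U : Set X, IsOpen U ∧ U.Nonempty ∧ trace S U ⊆ W := by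
  obtain ⟨p, hp⟩ := hne
  obtain ⟨_, ⟨U, hU, rfl⟩, hpU, hUW⟩ :=
    (isTopologicalBasis_trace S).exists_subset_of_mem_open hp hW
  exact ⟨U, hU, (inter_nonempty_of_mem_trace hU hU hpU hpU).mono inter_subset_left, hUW⟩

end Trace

/-! ### Sections of `kMap` and transfer of properties from `X` -/

section Section

variable {s : X → IliadisAbsolute X}

/-- The point of the section over `x`. -/
def sectionPoint (s : X → IliadisAbsolute X) (x : X) : range s := ⟨s x, x, rfl⟩

/-- The alternative `closure (closure U)ᶜ` cannot belong to the ultrafilter: it would contain `x`,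
so `U` would meet the complement of its own closure. -/
theorem sectionPoint_mem_trace [T2Space X] (hs : ∀ x, kMap X (s x) = x)
    {U : Set X} (hU : IsOpen U) {x : X} (hx : x ∈ U) :
    sectionPoint s x ∈ trace (range s) U := by
  refine ((s x).1.2.mem_or hU).resolve_right fun h => ?_
  have hxF := (kMap_eq_iff (s x) x).1 (hs x) _ h
  obtain ⟨y, hy, hy'⟩ := mem_closure_iff.1 hxF U hU hx
  exact hy' (subset_closure hy)

theorem mk_range_section (hs : ∀ x, kMap X (s x) = x) :
    #(range s) = #X :=
  mk_range_eq s (Function.LeftInverse.injective hs)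

theorem trace_nonempty [T2Space X] (hs : ∀ x, kMap X (s x) = x)
    {U : Set X} (hU : IsOpen U) (hne : U.Nonempty) :
    (trace (range s) U).Nonempty :=
  let ⟨_, hx⟩ := hne
  ⟨_, sectionPoint_mem_trace hs hU hx⟩

/-- If `closure V` belongs to the ultrafilter over `x`, then it contains `x`. Only `closure V` is
recovered, which is why semiregularity matters for the `π`-weight. -/
theorem trace_subset_iff [T2Space X] (hs : ∀ x, kMap X (s x) = x)
    {U V : Set X} (hU : IsOpen U) (hV : IsOpen V) :
    trace (range s) U ⊆ trace (range s) V ↔ U ⊆ closure V := by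
  refine ⟨fun h x hx => ?_, fun h p hp => ?_⟩
  · exact (kMap_eq_iff (s x) x).1 (hs x) _ (h (sectionPoint_mem_trace hs hU hx))
  · exact p.1.1.2.1.mono _ hp _ (isRegClosed_closure hV) (closure_minimal h isClosed_closure)

theorem dense_range_section [T2Space X] (hs : ∀ x, kMap X (s x) = x) :
    Dense (range s) := by
  refine dense_iff_inter_open.2 fun W hW hne => ?_
  obtain ⟨O, hO, rfl⟩ := isOpen_induced_iff.1 hW
  obtain ⟨p, hp⟩ := hne
  obtain ⟨_, ⟨U, hU, rfl⟩, hpU, hUO⟩ := isTopologicalBasis_lam.exists_subset_of_mem_open hp hO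
  obtain ⟨x, hx, -⟩ := p.1.2.1.inter_nonempty hU hU hpU hpU
  exact ⟨s x, hUO (sectionPoint_mem_trace hs hU hx), x, rfl⟩

theorem existsUnique_mem_range_section (hs : ∀ x, kMap X (s x) = x)
    (x : X) : ∃! F, F ∈ range s ∧ kMap X F = x := by
  refine ⟨s x, ⟨⟨x, rfl⟩, hs x⟩, ?_⟩
  rintro _ ⟨⟨y, rfl⟩, hy⟩
  rw [← hy, hs]

theorem extremallyDisconnected_section [T2Space X] (hs : ∀ x, kMap X (s x) = x) :
    ExtremallyDisconnected (range s) := by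
  refine ⟨fun W hW => ?_⟩
  -- The largest candidate: the closure of `W` is the trace of the union of all open sets whose
  -- trace lies in `W`.
  let U : Set X := ⋃₀ {V | IsOpen V ∧ trace (range s) V ⊆ W}
  have hU : IsOpen U := isOpen_sUnion fun V hV => hV.1
  have hWU : closure W = trace (range s) U := by
    refine (closure_minimal (fun p hp => ?_) (isClopen_trace _ hU).1).antisymm fun p hp => ?_
    · obtain ⟨_, ⟨V, hV, rfl⟩, hpV, hVW⟩ :=
        (isTopologicalBasis_trace (range s)).exists_subset_of_mem_open hp hW
      exact trace_mono hU (subset_sUnion_of_mem (show V ∈ {V | _} from ⟨hV, hVW⟩)) hpV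
    · refine (isTopologicalBasis_trace (range s)).mem_closure_iff.2 ?_
      rintro _ ⟨O, hO, rfl⟩ hpO
      obtain ⟨x, hxO, V, ⟨hV, hVW⟩, hxV⟩ := inter_nonempty_of_mem_trace hO hU hpO hp
      exact ⟨_, sectionPoint_mem_trace hs hO hxO, hVW (sectionPoint_mem_trace hs hV hxV)⟩
  rw [hWU]
  exact isOpen_trace _ hU

theorem perfectSpace_section [T2Space X] (hs : ∀ x, kMap X (s x) = x)
    [PerfectSpace X] : PerfectSpace (range s) := by
  refine perfectSpace_of_forall_exists_ne fun p W hW hp => ?_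
  obtain ⟨U, hU, ⟨x, hx⟩, hUW⟩ := exists_trace_subset hW ⟨p, hp⟩
  -- Distinct points `x, y ∈ U` have distinct section points in `W`, so at least one of these
  -- differs from `p`.
  obtain ⟨y, hy, hyx⟩ := exists_mem_ne_of_isOpen hU hx
  by_cases h : sectionPoint s x = p
  · refine ⟨_, hUW (sectionPoint_mem_trace hs hU hy), fun h' => hyx ?_⟩
    exact Function.LeftInverse.injective hs (Subtype.ext_iff.1 (h'.trans h.symm))
  · exact ⟨_, hUW (sectionPoint_mem_trace hs hU hx), h⟩

theorem cellularity_section [T2Space X] (hs : ∀ x, kMap X (s x) = x) :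
    cellularity (range s) = cellularity X := by
  refine le_antisymm (cellularity_le aleph0_le_cellularity fun C hC => ?_)
    (cellularity_le aleph0_le_cellularity fun C hC => ?_)
  · choose U hU hne hUV using fun V : C => exists_trace_subset (hC.1 _ V.2).1 (hC.1 _ V.2).2
    refine mk_le_cellularity U hU hne fun V W h => disjoint_left.2 fun x hxV hxW => ?_
    exact disjoint_left.1 (hC.2 V.2 W.2 fun h' => h (Subtype.ext h'))
      (hUV _ (sectionPoint_mem_trace hs (hU V) hxV)) (hUV _ (sectionPoint_mem_trace hs (hU W) hxW))
  · refine mk_le_cellularity (fun V : C => trace (range s) V.1) (fun V => isOpen_trace _ (hC.1 _ V.2).1)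
      (fun V => trace_nonempty hs (hC.1 _ V.2).1 (hC.1 _ V.2).2) fun V W h =>
        disjoint_left.2 fun p hpV hpW => ?_
    obtain ⟨x, hxV, hxW⟩ := inter_nonempty_of_mem_trace (hC.1 _ V.2).1 (hC.1 _ W.2).1 hpV hpW
    exact disjoint_left.1 (hC.2 V.2 W.2 fun h' => h (Subtype.ext h')) hxV hxW

theorem piWeight_section_le [T2Space X] (hs : ∀ x, kMap X (s x) = x) :
    piWeight (range s) ≤ piWeight X := by
  obtain ⟨B, hB, hBκ⟩ := exists_isPiBase_mk_le (X := X)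
  refine piWeight_le_of_family aleph0_le_piWeight hBκ (fun V => trace (range s) V.1)
    (fun V => isOpen_trace _ (hB.1 _ V.2).1)
    (fun V => trace_nonempty hs (hB.1 _ V.2).1 (hB.1 _ V.2).2) fun W hW hne => ?_
  obtain ⟨U, hU, hne, hUW⟩ := exists_trace_subset hW hne
  obtain ⟨V, hV, hVU⟩ := hB.2 U hU hne
  exact ⟨⟨V, hV⟩, (trace_mono hU hVU).trans hUW⟩

theorem piWeight_section [T2Space X] (hs : ∀ x, kMap X (s x) = x)
    (hX : IsSemiregular X) : piWeight (range s) = piWeight X := by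
  refine (piWeight_section_le hs).antisymm ?_
  obtain ⟨B, hB, hBκ⟩ := exists_isPiBase_mk_le (X := range s)
  choose U hU hne hUV using fun V : B => exists_trace_subset (hB.1 _ V.2).1 (hB.1 _ V.2).2
  refine piWeight_le_of_family aleph0_le_piWeight hBκ U hU hne fun O hO hOne => ?_
  obtain ⟨x, hx⟩ := hOne
  obtain ⟨R, hR, hxR, hRO⟩ := hX.exists_subset_of_mem_open hx hO
  have hRo : IsOpen R := hX.isOpen hR
  obtain ⟨V, hV, hVR⟩ := hB.2 _ (isOpen_trace (range s) hRo) (trace_nonempty hs hRo ⟨x, hxR⟩)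
  refine ⟨⟨V, hV⟩, Subset.trans ?_ hRO⟩
  -- The trace inclusion gives `U ⊆ closure R`; regularity of `R` turns this into `U ⊆ R`.
  rw [← (hR : interior (closure R) = R)]
  exact interior_maximal
    ((trace_subset_iff hs (hU _) hRo).1 ((hUV ⟨V, hV⟩).trans hVR)) (hU _)

end Section

theorem exists_section [T2Space X] : ∃ s : X → IliadisAbsolute X, ∀ x, kMap X (s x) = x := by
  choose F hF hxF using exists_isRegUltrafilter (X := X)
  exact ⟨fun x => ⟨⟨F x, hF x⟩, x, hxF x⟩, fun x => (kMap_eq_iff _ x).2 (hxF x)⟩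

end Absolute

namespace Absolute

/-! ### Dense subsets of Cantor cubes -/

section CantorCube

variable {I : Type u}

/-- The canonical open subsets of the Cantor cube. -/
def cylinder (p : Finset I × (I → ZMod 2)) : Set (I → ZMod 2) := {z | ∀ i ∈ p.1, z i = p.2 i}

theorem isClopen_cylinder (p : Finset I × (I → ZMod 2)) : IsClopen (cylinder p) := by
  have h : cylinder p = ⋂ i ∈ p.1, (fun z : I → ZMod 2 => z i) ⁻¹' {p.2 i} := by
    ext z
    simp [cylinder]
  rw [h]
  exact isClopen_biInter_finset fun i _ => (isClopen_discrete _).preimage (continuous_apply i)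

theorem exists_cylinder_subset {W : Set (I → ZMod 2)} (hW : IsOpen W) {z : I → ZMod 2}
    (hz : z ∈ W) : ∃ F : Finset I, cylinder (F, z) ⊆ W := by
  obtain ⟨F, u, hu, hW⟩ := isOpen_pi_iff.1 hW z hz
  exact ⟨F, fun y hy => hW fun i hi => by rw [hy i hi]; exact (hu i hi).2⟩

/-- The Cantor cube has countable cellularity. -/
theorem countable_of_pairwise_disjoint {ι : Type*} {f : ι → Set (I → ZMod 2)}
    (ho : ∀ i, IsOpen (f i)) (hne : ∀ i, (f i).Nonempty)
    (hf : Pairwise (Function.onFun Disjoint f)) : Countable ι := by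
  let _ : MeasurableSpace (I → ZMod 2) := borel _
  have : BorelSpace (I → ZMod 2) := ⟨rfl⟩
  -- The cube is a compact group, so Haar measure is finite and positive on non-empty open sets;
  -- only countably many disjoint sets can have positive measure.
  let μ : MeasureTheory.Measure (I → ZMod 2) := MeasureTheory.Measure.addHaar
  have h := MeasureTheory.Measure.countable_meas_pos_of_disjoint_iUnion (μ := μ)
    (fun i => (ho i).measurableSet) hf
  have huniv : {i | 0 < μ (f i)} = Set.univ :=
    eq_univ_of_forall fun i => (ho i).measure_pos μ (hne i)
  rw [huniv] at h
  exact countable_univ_iff.1 h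

variable {Z : Set (I → ZMod 2)}

theorem isZeroDimensional_cube_subset : IsZeroDimensional Z := by
  refine TopologicalSpace.isTopologicalBasis_of_isOpen_of_nhds (fun U hU => hU.2) fun z U hz hU => ?_
  obtain ⟨W, hW, rfl⟩ := isOpen_induced_iff.1 hU
  obtain ⟨F, hF⟩ := exists_cylinder_subset hW hz
  exact ⟨Subtype.val ⁻¹' cylinder (F, z.1), (isClopen_cylinder _).preimage continuous_subtype_val,
    fun _ _ => rfl, preimage_mono hF⟩

theorem exists_mem_cylinder (hZ : Dense Z) (p : Finset I × (I → ZMod 2)) :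
    ∃ z : Z, z.1 ∈ cylinder p := by
  obtain ⟨z, hz, hzZ⟩ := hZ.inter_open_nonempty _ (isClopen_cylinder p).2 ⟨p.2, fun _ _ => rfl⟩
  exact ⟨⟨z, hzZ⟩, hz⟩

/-- A dense subset of the cube takes every value at a coordinate outside the support of a cylinder. -/
theorem exists_mem_cylinder_apply_eq (hZ : Dense Z) (F : Finset I) (y : I → ZMod 2) {i : I}
    (hi : i ∉ F) (a : ZMod 2) : ∃ z : Z, z.1 ∈ cylinder (F, y) ∧ z.1 i = a := by
  classical
  obtain ⟨z, hz⟩ := exists_mem_cylinder hZ (insert i F, Function.update y i a)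
  refine ⟨z, fun j hj => ?_, ?_⟩
  · have hne : j ≠ i := fun h => hi (h ▸ hj)
    simpa [hne] using hz j (Finset.mem_insert_of_mem hj)
  · simpa using hz i (Finset.mem_insert_self i F)

theorem perfectSpace_of_dense_cube [Infinite I] (hZ : Dense Z) : PerfectSpace Z := by
  refine perfectSpace_of_forall_exists_ne fun z U hU hz => ?_
  obtain ⟨W, hW, rfl⟩ := isOpen_induced_iff.1 hU
  obtain ⟨F, hF⟩ := exists_cylinder_subset hW hz
  obtain ⟨i, hi⟩ := Infinite.exists_notMem_finset F
  -- Flipping a coordinate outside the support stays in the cylinder and leaves `z`.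
  obtain ⟨w, hw, hwi⟩ := exists_mem_cylinder_apply_eq hZ F z.1 hi (z.1 i + 1)
  refine ⟨w, hF hw, fun h => ?_⟩
  rw [h] at hwi
  simp at hwi

theorem cellularity_of_dense_cube (hZ : Dense Z) : cellularity Z = ℵ₀ := by
  refine (cellularity_le le_rfl fun C hC => ?_).antisymm aleph0_le_cellularity
  choose W hW hWV using fun V : C => isOpen_induced_iff.1 (hC.1 _ V.2).1
  rw [mk_le_aleph0_iff]
  refine countable_of_pairwise_disjoint hW (fun V => ?_) fun V V' h => ?_
  · obtain ⟨z, hz⟩ := (hC.1 _ V.2).2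
    rw [← hWV V] at hz
    exact ⟨_, hz⟩
  · rw [Function.onFun, disjoint_iff_inter_eq_empty, ← not_nonempty_iff_eq_empty]
    -- Open extensions to the cube of disjoint sets stay disjoint: a non-empty open intersection
    -- would meet the dense set `Z`.
    intro hne
    obtain ⟨z, ⟨hz, hz'⟩, hzZ⟩ := hZ.inter_open_nonempty _ ((hW V).inter (hW V')) hne
    refine disjoint_left.1 (hC.2 V.2 V'.2 fun h' => h (Subtype.ext h'))
      (?_ : (⟨z, hzZ⟩ : Z) ∈ V.1) (?_ : (⟨z, hzZ⟩ : Z) ∈ V'.1)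
    · rw [← hWV V]
      exact hz
    · rw [← hWV V']
      exact hz'

theorem piWeight_cube_le [Infinite I] (hZ : Dense Z) : piWeight Z ≤ #I := by
  classical
  -- A cylinder depends only on the values on its finite support, so finitely supported 0-1 vectors
  -- suffice and only `#I` cylinders are needed.
  let g : Finset I × Finset I → Finset I × (I → ZMod 2) :=
    fun q => (q.1, fun i => if i ∈ q.2 then 1 else 0)
  refine piWeight_le_of_family (ι := Finset I × Finset I) (aleph0_le_mk I) ?_
    (fun q => Subtype.val ⁻¹' cylinder (g q))
    (fun q => (isClopen_cylinder _).2.preimage continuous_subtype_val)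
    (fun q => exists_mem_cylinder hZ _) fun U hU ⟨z, hz⟩ => ?_
  · rw [← Cardinal.mul_def, mk_finset_of_infinite, mul_eq_self (aleph0_le_mk I)]
  · obtain ⟨W, hW, rfl⟩ := isOpen_induced_iff.1 hU
    obtain ⟨F, hF⟩ := exists_cylinder_subset hW hz
    refine ⟨(F, F.filter fun i => z.1 i = 1), preimage_mono fun y hy => hF fun i hi => ?_⟩
    have h01 : ∀ a : ZMod 2, a = 0 ∨ a = 1 := by decide
    rw [hy i hi]
    rcases h01 (z.1 i) with h | h <;> simp_all [g]

theorem mk_le_piWeight_cube [Infinite I] (hZ : Dense Z) : #I ≤ piWeight Z := by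
  obtain ⟨B, hB, hBκ⟩ := exists_isPiBase_mk_le (X := Z)
  have hex : ∀ V : B, ∃ (F : Finset I) (y : I → ZMod 2), Subtype.val ⁻¹' cylinder (F, y) ⊆ V.1 := by
    intro V
    obtain ⟨z, hz⟩ := (hB.1 _ V.2).2
    obtain ⟨W, hW, hWV⟩ := isOpen_induced_iff.1 (hB.1 _ V.2).1
    rw [← hWV] at hz ⊢
    obtain ⟨F, hF⟩ := exists_cylinder_subset hW hz
    exact ⟨F, z.1, preimage_mono hF⟩
  choose F y hFy using hex
  -- The finite supports must cover `I`: if `i` were in none, a member inside `{z | z i = 1}` would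
  -- contain a cylinder not restricting `i`, hence a point with `z i = 0`. Thus `#I ≤ #B * ℵ₀`.
  have hcover : (⋃ V : B, (F V : Set I)) = Set.univ := by
    refine eq_univ_of_forall fun i => ?_
    by_contra hi
    have hi' : ∀ V, i ∉ F V := fun V h => hi (mem_iUnion.2 ⟨V, h⟩)
    have ho : IsOpen {z : Z | z.1 i = 1} := (isOpen_discrete {(1 : ZMod 2)}).preimage
      (f := fun z : Z => z.1 i) ((continuous_apply i).comp continuous_subtype_val)
    obtain ⟨z, -, hz⟩ := exists_mem_cylinder_apply_eq hZ ∅ 0 (Finset.notMem_empty i) 1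
    obtain ⟨V, hV, hVi⟩ := hB.2 _ ho ⟨z, hz⟩
    obtain ⟨w, hw, hwi⟩ := exists_mem_cylinder_apply_eq hZ (F ⟨V, hV⟩) (y ⟨V, hV⟩) (hi' _) 0
    have : w.1 i = 1 := hVi (hFy ⟨V, hV⟩ hw)
    rw [hwi] at this
    exact zero_ne_one this
  rw [← mk_univ (α := I), ← hcover]
  refine (mk_iUnion_le _).trans ?_
  refine (mul_le_mul' hBκ (ciSup_le' fun V => ?_)).trans (mul_aleph0_eq aleph0_le_piWeight).le
  exact (mk_le_aleph0 (α := F V))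

/-- The Hewitt–Marczewski–Pondiczery theorem for powers of the two-point space, with an independent
family as the dense set. -/
theorem exists_dense_cube {X : Type u} [Infinite X] (I : Set (Set X)) :
    ∃ Z : Set (I → ZMod 2), Dense Z ∧ #Z ≤ #X := by
  classical
  -- Coordinates are subsets `A` of `X`, and the point given by `(D, E)` has coordinate 1 at `A`
  -- exactly when `D ∩ A ∈ E`.
  let g : Finset X × Finset (Finset X) → I → ZMod 2 :=
    fun q A => if (q.1.filter fun x => x ∈ A.1) ∈ q.2 then 1 else 0
  refine ⟨range g, ?_, ?_⟩
  · refine dense_iff_inter_open.2 fun W hW ⟨z, hz⟩ => ?_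
    obtain ⟨F, hF⟩ := exists_cylinder_subset hW hz
    have hsep : ∀ q : I × I, ∃ x : X, q.1 ≠ q.2 → ¬ (x ∈ q.1.1 ↔ x ∈ q.2.1) := by
      intro q
      by_cases h : q.1 = q.2
      · exact ⟨Classical.arbitrary X, fun h' => (h' h).elim⟩
      · by_contra! hall
        exact h (Subtype.ext (Set.ext fun x => (hall x).2))
    choose d hd using hsep
    -- `D` contains a point separating each pair of distinct members of `F`, so their traces on `D`
    -- are distinct and any 0-1 pattern is prescribed by choosing which traces to put in `E`.
    let D : Finset X := (F ×ˢ F).image d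
    let t : I → Finset X := fun A => D.filter fun x => x ∈ A.1
    have ht : ∀ A ∈ F, ∀ B ∈ F, t A = t B → A = B := by
      intro A hA B hB h
      by_contra hne
      have hD : d (A, B) ∈ D := Finset.mem_image_of_mem d (Finset.mk_mem_product hA hB)
      have := Finset.ext_iff.1 h (d (A, B))
      simp only [t, Finset.mem_filter, hD, true_and] at this
      exact hd (A, B) hne this
    refine ⟨_, hF ?_, (D, (F.filter fun A => z A = 1).image t), rfl⟩
    intro A hA
    have hiff : t A ∈ (F.filter fun A => z A = 1).image t ↔ z A = 1 := by
      rw [Finset.mem_image]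
      refine ⟨?_, fun h => ⟨A, Finset.mem_filter.2 ⟨hA, h⟩, rfl⟩⟩
      rintro ⟨B, hB, hBA⟩
      rw [Finset.mem_filter] at hB
      rw [← ht B hB.1 A hA hBA]
      exact hB.2
    have h01 : ∀ a : ZMod 2, (if a = 1 then (1 : ZMod 2) else 0) = a := by decide
    change (if t A ∈ (F.filter fun A => z A = 1).image t then (1 : ZMod 2) else 0) = z A
    rw [if_congr hiff rfl rfl]
    exact h01 _
  · refine mk_range_le.trans ?_
    rw [← Cardinal.mul_def, mk_finset_of_infinite, mk_finset_of_infinite, mk_finset_of_infinite,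
      mul_eq_self (aleph0_le_mk X)]

end CantorCube

end Absolute

/-! ### The auxiliary space and the conclusion -/

namespace Absolute

theorem piWeight_le_mk_set (X : Type u) [TopologicalSpace X] [Infinite X] :
    piWeight X ≤ #(Set X) :=
  piWeight_le_of_family (ι := {V : Set X // IsOpen V ∧ V.Nonempty})
    ((aleph0_le_mk X).trans (by rw [mk_set]; exact (cantor _).le)) (mk_subtype_le _)
    Subtype.val (fun V => V.2.1) (fun V => V.2.2) fun U hU h => ⟨⟨U, hU, h⟩, subset_rfl⟩

theorem isZeroDimensional_sum {X Y : Type u} [TopologicalSpace X] [TopologicalSpace Y]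
    (hX : IsZeroDimensional X) (hY : IsZeroDimensional Y) : IsZeroDimensional (X ⊕ Y) := by
  refine TopologicalSpace.isTopologicalBasis_of_isOpen_of_nhds (fun U hU => hU.2) ?_
  rintro (x | y) U hz hU
  · obtain ⟨V, hV, hxV, hVU⟩ := hX.exists_subset_of_mem_open
      (show x ∈ Sum.inl ⁻¹' U from hz) (hU.preimage continuous_inl)
    exact ⟨Sum.inl '' V, ⟨IsClosedEmbedding.inl.isClosedMap _ hV.1, isOpenMap_inl _ hV.2⟩,
      mem_image_of_mem _ hxV, image_subset_iff.2 hVU⟩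
  · obtain ⟨V, hV, hxV, hVU⟩ := hY.exists_subset_of_mem_open
      (show y ∈ Sum.inr ⁻¹' U from hz) (hU.preimage continuous_inr)
    exact ⟨Sum.inr '' V, ⟨IsClosedEmbedding.inr.isClosedMap _ hV.1, isOpenMap_inr _ hV.2⟩,
      mem_image_of_mem _ hxV, image_subset_iff.2 hVU⟩

theorem perfectSpace_sum {X Y : Type u} [TopologicalSpace X] [TopologicalSpace Y]
    [PerfectSpace X] [PerfectSpace Y] : PerfectSpace (X ⊕ Y) := by
  refine perfectSpace_of_forall_exists_ne ?_
  rintro (x | y) U hU hz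
  · obtain ⟨w, hw, hne⟩ := exists_mem_ne_of_isOpen (hU.preimage continuous_inl) hz
    exact ⟨_, hw, fun h => hne (Sum.inl_injective h)⟩
  · obtain ⟨w, hw, hne⟩ := exists_mem_ne_of_isOpen (hU.preimage continuous_inr) hz
    exact ⟨_, hw, fun h => hne (Sum.inr_injective h)⟩

/-- A non-empty crowded Hausdorff space can be replaced by a zero-dimensional one with the same
cardinality, `π`-weight and cellularity: the sum of a section of the absolute and of a dense subset
of a Cantor cube. -/
theorem exists_isZeroDimensional_same_cardinals (X : Type u) [TopologicalSpace X] [T2Space X]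
    [PerfectSpace X] [Nonempty X] :
    ∃ (Y : Type u) (_ : TopologicalSpace Y), IsZeroDimensional Y ∧ T2Space Y ∧ PerfectSpace Y ∧
      #Y = #X ∧ piWeight Y = piWeight X ∧ cellularity Y = cellularity X := by
  have : Infinite X := infinite_univ_iff.1 (infinite_of_isOpen isOpen_univ univ_nonempty)
  obtain ⟨s, hs⟩ := exists_section (X := X)
  -- Since `πw(X) ≤ 2 ^ |X|`, the index set of the cube can be a family of subsets of `X`, as the
  -- dense set construction requires.
  obtain ⟨I, hI⟩ := le_mk_iff_exists_set.1 (piWeight_le_mk_set X)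
  have : Infinite I := infinite_iff.2 (hI ▸ aleph0_le_piWeight)
  obtain ⟨Z, hZ, hZX⟩ := exists_dense_cube I
  have := t2Space_of_subset (range s)
  have := perfectSpace_section hs
  have := perfectSpace_of_dense_cube hZ
  refine ⟨range s ⊕ Z, inferInstance,
    isZeroDimensional_sum (isZeroDimensional_of_subset _) isZeroDimensional_cube_subset,
    inferInstance, perfectSpace_sum, ?_, ?_, ?_⟩
  · rw [← Cardinal.add_def, mk_range_section hs]
    exact add_eq_left (aleph0_le_mk X) hZX
  · refine (piWeight_sum_le (piWeight_section_le hs) ((piWeight_cube_le hZ).trans hI.le)).antisymm ?_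
    rw [← hI]
    exact (mk_le_piWeight_cube hZ).trans piWeight_le_sum_right
  · refine (cellularity_sum_le (cellularity_section hs).le ?_).antisymm ?_
    · rw [cellularity_of_dense_cube hZ]
      exact aleph0_le_cellularity
    · rw [← cellularity_section hs]
      exact cellularity_le_sum_left

theorem exists_dense_section (X : Type u) [TopologicalSpace X] [T2Space X] [PerfectSpace X] :
    ∃ sX : Set (IliadisAbsolute X),
      Dense sX ∧ (∀ x : X, ∃! F, F ∈ sX ∧ kMap X F = x) ∧
      ExtremallyDisconnected sX ∧ IsZeroDimensional sX ∧ T2Space sX ∧ PerfectSpace sX ∧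
      IsSHD sX ∧
      #sX = #X ∧ cellularity sX = cellularity X ∧ piWeight sX ≤ piWeight X ∧
      (IsSemiregular X → piWeight sX = piWeight X) := by
  obtain ⟨s, hs⟩ := exists_section (X := X)
  have hT := t2Space_of_subset (range s)
  have hE := extremallyDisconnected_section hs
  have hP := perfectSpace_section hs
  exact ⟨range s, dense_range_section hs, existsUnique_mem_range_section hs, hE,
    isZeroDimensional_of_subset _, hT, hP, isSHD_of_extremallyDisconnected, mk_range_section hs,
    cellularity_section hs, piWeight_section_le hs, piWeight_section hs⟩

end Absolute

open Absolute in
theorem mainTheorem2 (X : Type u) [TopologicalSpace X] [T2Space X] [PerfectSpace X] :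
    (∃ (sX : Type u) (_ : TopologicalSpace sX),
      ExtremallyDisconnected sX ∧ IsZeroDimensional sX ∧ T2Space sX ∧ PerfectSpace sX ∧
      IsSHD sX ∧
      #sX = #X ∧ piWeight sX = piWeight X ∧ cellularity sX = cellularity X) ∧
    (∃ sX : Set (IliadisAbsolute X),
      Dense sX ∧ (∀ x : X, ∃! F, F ∈ sX ∧ kMap X F = x) ∧
      ExtremallyDisconnected sX ∧ IsZeroDimensional sX ∧ T2Space sX ∧ PerfectSpace sX ∧
      IsSHD sX ∧
      #sX = #X ∧ cellularity sX = cellularity X ∧ piWeight sX ≤ piWeight X ∧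
      (IsSemiregular X → piWeight sX = piWeight X)) := by
  refine ⟨?_, exists_dense_section X⟩
  -- The empty space is its own replacement; the sum with the non-empty `Z` would change its
  -- cardinality.
  obtain ⟨Y, _, hY0, _, _, hYX, hπ, hc⟩ : ∃ (Y : Type u) (_ : TopologicalSpace Y),
      IsSemiregular Y ∧ T2Space Y ∧ PerfectSpace Y ∧
      #Y = #X ∧ piWeight Y = piWeight X ∧ cellularity Y = cellularity X := by
    rcases isEmpty_or_nonempty X with hX | hX
    · exact ⟨X, inferInstance, TopologicalSpace.isTopologicalBasis_of_isOpen_of_nhds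
        (fun U hU => by rw [Set.eq_empty_of_isEmpty U]; exact isOpen_empty) fun x => isEmptyElim x,
        inferInstance, inferInstance, rfl, rfl, rfl⟩
    · obtain ⟨Y, i, h0, h⟩ := exists_isZeroDimensional_same_cardinals X
      exact ⟨Y, i, h0.isSemiregular, h⟩
  -- A second passage to the absolute, since the cube summand of `Y` need not be extremally
  -- disconnected. Semiregularity of `Y` keeps the `π`-weight this time.
  obtain ⟨S, -, -, hE, h0, hT, hP, hSHD, hS, hSc, -, hSπ⟩ := exists_dense_section Y
  exact ⟨S, inferInstance, hE, h0, hT, hP, hSHD, hS.trans hYX, (hSπ hY0).trans hπ, hSc.trans hc⟩
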